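/- Let $R$ be a commutative ring with unity and let $C$ be a semidualizing $R$-module, i.e. $C$ admits a resolution by finitely generated projective $R$-modules, the homothety map $R\to\operatorname{Hom}_R(C,C)$ is an isomorphism, and $\operatorname{Ext}^i_R(C,C)=0$ for all $i\ge 1$. An $R$-module $M$ is called $G_C$-projective if there is an exact sequence $$\mathbb X=\cdots\to P_1\to P_0\to C\otimes_R P_{-1}\to C\otimes_R P_{-2}\to\cdots$$ with all $P_i$ projective such that $M\cong\operatorname{im}(P_0\to C\otimes_R P_{-1})$ and $\operatorname{Hom}_R(\mathbb X,C\otimes_R P)$ is exact for every projective $R$-module $P$. It is called $G_C$-flat if there is an exact sequence $$\mathbb Y=\cdots\to F_1\to F_0\to C\otimes_R F_{-1}\to C\otimes_R F_{-2}\to\cdots$$ with all $F_i$ flat such that $M\cong\operatorname{im}(F_0\to C\otimes_R F_{-1})$ and $\operatorname{Hom}_R(C,I)\otimes_R\mathbb Y$ is exact for every injective $R$-module $I$. The ring $R$ is called $C$-Gorenstein hereditary if every submodule of a projective $R$-module is $G_C$-projective, and $C$-Gorenstein semihereditary if $R$ is coherent (every finitely generated ideal is finitely presented) and every submodule of a flat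 $R$-module is $G_C$-flat. **Theorem.** If $R$ is $C$-Gorenstein hereditary, then $R$ is $C$-Gorenstein semihereditary; that is, $R$ is coherent and every submodule of a flat $R$-module is $G_C$-flat. -/

import Mathlib

open scoped TensorProduct

universe u

/-- `R` is coherent: every finitely generated ideal is finitely presented. -/
def IsCoherentRing (R : Type u) [CommRing R] : Prop :=
  ∀ I : Ideal R, I.FG → Module.FinitePresentation R I

/-- `C` admits a degreewise finite projective resolution: an exact sequence
`⋯ → P 1 → P 0 → C → 0` with every `P n` finitely generated projective. -/
def HasDegreewiseFiniteProjectiveResolution (R : Type u) [CommRing R]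
    (C : Type u) [AddCommGroup C] [Module R C] : Prop :=
  ∃ (P : ℕ → ModuleCat.{u} R) (d : ∀ n, P (n + 1) →ₗ[R] P n) (ε : P 0 →ₗ[R] C),
    (∀ n, Module.Projective R (P n) ∧ Module.Finite R (P n)) ∧
    Function.Surjective ε ∧ Function.Exact (d 0) ε ∧
    ∀ n, Function.Exact (d (n + 1)) (d n)

/-- Semidualizing modules over a commutative ring. The map `LinearMap.lsmul R C` is the
homothety map `R → Hom_R(C, C)`. -/
structure IsSemidualizing (R : Type u) [CommRing R]
    (C : Type u) [AddCommGroup C] [Module R C] : Prop where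
  resolution : HasDegreewiseFiniteProjectiveResolution R C
  homothety : Function.Bijective (LinearMap.lsmul R C)
  ext_eq_zero : ∀ i : ℕ, 1 ≤ i →
    Subsingleton (CategoryTheory.Abelian.Ext (ModuleCat.of R C) (ModuleCat.of R C) i)

/-- `N` is `C`-projective: it has the form `C ⊗ P` with `P` projective. -/
def IsCProjective (R : Type u) [CommRing R] (C : Type u) [AddCommGroup C] [Module R C]
    (N : Type u) [AddCommGroup N] [Module R N] : Prop :=
  ∃ P : ModuleCat.{u} R, Module.Projective R P ∧ Nonempty (N ≃ₗ[R] C ⊗[R] P)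

/-- `N` has the form `C ⊗ F` with `F` flat. -/
def IsCFlat (R : Type u) [CommRing R] (C : Type u) [AddCommGroup C] [Module R C]
    (N : Type u) [AddCommGroup N] [Module R N] : Prop :=
  ∃ F : ModuleCat.{u} R, Module.Flat R F ∧ Nonempty (N ≃ₗ[R] C ⊗[R] F)

/-- A two-sided sequence of modules and linear maps
`⋯ → L 1 → L 0 → K 0 → K 1 → ⋯`, with the middle map `mid : L 0 → K 0`. -/
structure TwoSidedSeq (R : Type u) [CommRing R] where
  L : ℕ → ModuleCat.{u} R
  K : ℕ → ModuleCat.{u} R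
  dL : ∀ n, L (n + 1) →ₗ[R] L n
  mid : L 0 →ₗ[R] K 0
  dK : ∀ n, K n →ₗ[R] K (n + 1)

namespace TwoSidedSeq

variable {R : Type u} [CommRing R]

/-- The sequence `X` is exact at every term. -/
structure IsExact (X : TwoSidedSeq R) : Prop where
  left : ∀ n, Function.Exact (X.dL (n + 1)) (X.dL n)
  midLeft : Function.Exact (X.dL 0) X.mid
  midRight : Function.Exact X.mid (X.dK 0)
  right : ∀ n, Function.Exact (X.dK n) (X.dK (n + 1))

/-- The sequence `Hom_R(X, W)` is exact at every term. -/
structure IsHomExact (X : TwoSidedSeq R) (W : Type u) [AddCommGroup W] [Module R W] :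
    Prop where
  left : ∀ n, Function.Exact ((X.dL n).lcomp R W) ((X.dL (n + 1)).lcomp R W)
  midLeft : Function.Exact (X.mid.lcomp R W) ((X.dL 0).lcomp R W)
  midRight : Function.Exact ((X.dK 0).lcomp R W) (X.mid.lcomp R W)
  right : ∀ n, Function.Exact ((X.dK (n + 1)).lcomp R W) ((X.dK n).lcomp R W)

/-- The sequence `H ⊗_R X` is exact at every term. -/
structure IsTensorExact (X : TwoSidedSeq R) (H : Type u) [AddCommGroup H] [Module R H] :
    Prop where
  left : ∀ n, Function.Exact ((X.dL (n + 1)).lTensor H) ((X.dL n).lTensor H)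
  midLeft : Function.Exact ((X.dL 0).lTensor H) (X.mid.lTensor H)
  midRight : Function.Exact (X.mid.lTensor H) ((X.dK 0).lTensor H)
  right : ∀ n, Function.Exact ((X.dK n).lTensor H) ((X.dK (n + 1)).lTensor H)

end TwoSidedSeq

/-- `G_C`-projective modules. -/
def IsGCProjective (R : Type u) [CommRing R] (C : Type u) [AddCommGroup C] [Module R C]
    (M : Type u) [AddCommGroup M] [Module R M] : Prop :=
  ∃ X : TwoSidedSeq R,
    (∀ n, Module.Projective R (X.L n)) ∧ (∀ n, IsCProjective R C (X.K n)) ∧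
    X.IsExact ∧ Nonempty (M ≃ₗ[R] LinearMap.range X.mid) ∧
    ∀ (P : Type u) [AddCommGroup P] [Module R P], Module.Projective R P →
      X.IsHomExact (C ⊗[R] P)

/-- `G_C`-flat modules. -/
def IsGCFlat (R : Type u) [CommRing R] (C : Type u) [AddCommGroup C] [Module R C]
    (M : Type u) [AddCommGroup M] [Module R M] : Prop :=
  ∃ X : TwoSidedSeq R,
    (∀ n, Module.Flat R (X.L n)) ∧ (∀ n, IsCFlat R C (X.K n)) ∧
    X.IsExact ∧ Nonempty (M ≃ₗ[R] LinearMap.range X.mid) ∧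
    ∀ (I : Type u) [AddCommGroup I] [Module R I], Module.Injective R I →
      X.IsTensorExact (C →ₗ[R] I)

/-- `R` is `C`-Gorenstein hereditary: every submodule of a projective module is
`G_C`-projective. -/
def IsGCHereditary (R : Type u) [CommRing R] (C : Type u) [AddCommGroup C] [Module R C] :
    Prop :=
  ∀ (P : Type u) [AddCommGroup P] [Module R P], Module.Projective R P →
    ∀ N : Submodule R P, IsGCProjective R C N

/-- `R` is `C`-Gorenstein semihereditary: it is coherent and every submodule of a flat
module is `G_C`-flat. -/
def IsGCSemihereditary (R : Type u) [CommRing R] (C : Type u) [AddCommGroup C]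
    [Module R C] : Prop :=
  IsCoherentRing R ∧
    ∀ (F : Type u) [AddCommGroup F] [Module R F], Module.Flat R F →
      ∀ N : Submodule R F, IsGCFlat R C N

/-! Everything rests on a construction valid for an arbitrary module `M`
(`IsGCHereditary.nonempty_cEmbedding`). In a presentation 0 → A → B → M → 0 with `B` projective,
both `A` and `B` are `G_C`-projective, so each has a proper coresolution by `C`-projectives. The
cone of a lift of A → B is exact except for one homology module, which is `M`. Since `C ⊗ -` is
fully faithful on projectives, the first map of the cone is `C ⊗ f` for some f : P → Q. With T =
coker f, `M` embeds in `C ⊗ T`, and the cokernel has a coresolution by `C`-projectives.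

Both 0 → P → Q → T → 0 and its tensor product with `C` are exact, so Tor₁(Y, T) = 0 whenever `Y`
embeds in a flat module or in `C ⊗ F` with `F` flat. If `M = I` is injective, then `I` splits off `C
⊗ T`, hence Hom(C, I) splits off Hom(C, C ⊗ T) ≅ T and inherits this vanishing. The tensor condition
in the definition of `G_C`-flat is therefore automatic (`TwoSidedSeq.IsExact.isTensorExact`). If `N`
embeds in a flat module, then its `T` is flat (`CEmbedding.flat_T`), and splicing with a projective
resolution shows that `N` is `G_C`-flat.

For coherence, Chase's criterion reduces the claim to flatness of all powers R^J
(`IsGCHereditary.flat_pi`). Ideals are `G_C`-projective, so C^J has injective dimension at most one.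
Applying Hom(C, -) to 0 → C^J → E → E' → 0 gives a short exact sequence from R^J to modules Hom(C,
injective), so R^J has flat dimension at most one. Embedding an arbitrary `X` in `C ⊗ T` then
reduces Tor₁(X, R^J) to Tor₁(C ⊗ T, R^J), which vanishes by the finiteness of the resolution of `C`.
-/

section

variable {R : Type u} [CommRing R]

/-! ### Elementary calculus of vanishing Tor₁. -/

/-- A form of the snake lemma for a short exact sequence tensored with a presentation. -/
theorem rTensor_injective_of_presentation {A B D S S' T : Type u}
    [AddCommGroup A] [Module R A] [AddCommGroup B] [Module R B] [AddCommGroup D] [Module R D]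
    [AddCommGroup S] [Module R S] [AddCommGroup S'] [Module R S'] [AddCommGroup T] [Module R T]
    {i : A →ₗ[R] B} {p : B →ₗ[R] D} {f : S →ₗ[R] S'} {g : S' →ₗ[R] T}
    (hip : Function.Exact i p) (hp : Function.Surjective p)
    (hfg : Function.Exact f g) (hg : Function.Surjective g)
    (hi : Function.Injective (i.rTensor S')) (hf : Function.Injective (f.lTensor D)) :
    Function.Injective (i.rTensor T) := by
  rw [injective_iff_map_eq_zero]
  intro x hx
  obtain ⟨y, rfl⟩ := LinearMap.lTensor_surjective A hg x
  have h1 : g.lTensor B (i.rTensor S' y) = 0 := by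
    rw [← hx, ← LinearMap.comp_apply, ← LinearMap.comp_apply, LinearMap.lTensor_comp_rTensor,
      LinearMap.rTensor_comp_lTensor]
  obtain ⟨b, hb⟩ := (lTensor_exact B hfg hg _).1 h1
  -- Injectivity of `D ⊗ f` forces `b` to come from `A ⊗ S`, so `y` comes from there too and dies in
  -- `A ⊗ T`.
  have h2 : f.lTensor D (p.rTensor S b) = 0 := by
    rw [← LinearMap.comp_apply, LinearMap.lTensor_comp_rTensor, ← LinearMap.rTensor_comp_lTensor,
      LinearMap.comp_apply, hb]
    exact (rTensor_exact S' hip hp _).2 ⟨y, rfl⟩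
  obtain ⟨a, ha⟩ := (rTensor_exact S hip hp _).1 ((injective_iff_map_eq_zero _).1 hf _ h2)
  have h3 : f.lTensor A a = y := by
    apply hi
    rw [← hb, ← ha, ← LinearMap.comp_apply, ← LinearMap.comp_apply, LinearMap.lTensor_comp_rTensor,
      LinearMap.rTensor_comp_lTensor]
  rw [← h3]
  exact (lTensor_exact A hfg hg _).2 ⟨a, rfl⟩

theorem lTensor_injective_iff_rTensor_injective (M : Type u) {A B : Type u}
    [AddCommGroup M] [Module R M] [AddCommGroup A] [Module R A] [AddCommGroup B] [Module R B]
    (f : A →ₗ[R] B) :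
    Function.Injective (f.lTensor M) ↔ Function.Injective (f.rTensor M) := by
  rw [← LinearMap.comm_comp_rTensor_comp_comm_eq]
  simp

/-- Every module is the quotient of a projective module. -/
theorem exists_projective_presentation (R : Type u) [CommRing R] (X : Type u) [AddCommGroup X]
    [Module R X] : ∃ (A B : ModuleCat.{u} R) (i : A →ₗ[R] B) (p : B →ₗ[R] X),
      Module.Projective R B ∧ Function.Injective i ∧ Function.Exact i p ∧
        Function.Surjective p := by
  let p : (X →₀ R) →ₗ[R] X := Finsupp.linearCombination R (id : X → X)
  exact ⟨ModuleCat.of R (LinearMap.ker p), ModuleCat.of R (X →₀ R), (LinearMap.ker p).subtype, p,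
    inferInstanceAs (Module.Projective R (X →₀ R)), Submodule.injective_subtype _,
    LinearMap.exact_subtype_ker_map p, Finsupp.linearCombination_id_surjective R X⟩

/-- The vanishing of `Tor₁(X, N)`: tensoring with `N` preserves injectivity of every monomorphism
with cokernel `X`. -/
def TorOneVanishes (R : Type u) [CommRing R] (X N : Type u) [AddCommGroup X] [Module R X]
    [AddCommGroup N] [Module R N] : Prop :=
  ∀ (A B : Type u) [AddCommGroup A] [Module R A] [AddCommGroup B] [Module R B]
    (i : A →ₗ[R] B) (p : B →ₗ[R] X), Function.Injective i → Function.Exact i p →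
    Function.Surjective p → Function.Injective (i.rTensor N)

namespace TorOneVanishes

variable {X N : Type u} [AddCommGroup X] [Module R X] [AddCommGroup N] [Module R N]

/-- One presentation of `N` with flat middle term tests every monomorphism with cokernel `X`, by the
snake argument. -/
theorem of_presentation {S S' : Type u} [AddCommGroup S] [Module R S] [AddCommGroup S']
    [Module R S'] {f : S →ₗ[R] S'} {g : S' →ₗ[R] N} [Module.Flat R S']
    (hfg : Function.Exact f g) (hg : Function.Surjective g)
    (hf : Function.Injective (f.lTensor X)) : TorOneVanishes R X N := by
  intro A B _ _ _ _ i p hi hip hp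
  exact rTensor_injective_of_presentation hip hp hfg hg
    (Module.Flat.rTensor_preserves_injective_linearMap _ hi) hf

/-- Balancing of Tor₁: the hypothesis on a projective presentation of `X` is exactly the input that
`of_presentation` needs with the roles exchanged. -/
theorem symm (h : TorOneVanishes R X N) : TorOneVanishes R N X := by
  obtain ⟨A, B, i, p, hB, hi, hip, hp⟩ := exists_projective_presentation R X
  refine of_presentation hip hp ?_
  rw [lTensor_injective_iff_rTensor_injective]
  exact h _ _ _ p hi hip hp

theorem of_flat_right [Module.Flat R N] : TorOneVanishes R X N := by
  intro A B _ _ _ _ i p hi hip hp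
  exact Module.Flat.rTensor_preserves_injective_linearMap _ hi

theorem lTensor_injective (h : TorOneVanishes R X N) {A B : Type u} [AddCommGroup A] [Module R A]
    [AddCommGroup B] [Module R B] {i : A →ₗ[R] B} {p : B →ₗ[R] X} (hi : Function.Injective i)
    (hip : Function.Exact i p) (hp : Function.Surjective p) :
    Function.Injective (i.lTensor N) := by
  rw [lTensor_injective_iff_rTensor_injective]
  exact h _ _ i p hi hip hp

/-- `Tor₁(-, N)` vanishes on `W` if there is `U → V → W → 0` exact with `Tor₁(V, N) = 0` and
`U ⊗ N → V ⊗ N` injective. -/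
theorem of_exact {U V W : Type u} [AddCommGroup U] [Module R U] [AddCommGroup V] [Module R V]
    [AddCommGroup W] [Module R W] {f : U →ₗ[R] V} {g : V →ₗ[R] W}
    (hfg : Function.Exact f g) (hg : Function.Surjective g) (hV : TorOneVanishes R V N)
    (hf : Function.Injective (f.rTensor N)) : TorOneVanishes R W N := by
  apply symm
  intro A B _ _ _ _ i p hi hip hp
  exact rTensor_injective_of_presentation hip hp hfg hg (hV.symm _ _ i p hi hip hp)
    ((lTensor_injective_iff_rTensor_injective _ _).2 hf)

theorem of_retract_right {N' : Type u} [AddCommGroup N'] [Module R N'] (h : TorOneVanishes R X N)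
    (s : N' →ₗ[R] N) (r : N →ₗ[R] N') (hrs : r ∘ₗ s = LinearMap.id) : TorOneVanishes R X N' := by
  intro A B _ _ _ _ i p hi hip hp
  have h1 : Function.Injective (s.lTensor A) := by
    apply Function.LeftInverse.injective (g := r.lTensor A)
    intro x
    rw [← LinearMap.comp_apply, ← LinearMap.lTensor_comp, hrs, LinearMap.lTensor_id,
      LinearMap.id_apply]
  have h2 := (h _ _ i p hi hip hp).comp h1
  rw [← LinearMap.coe_comp, LinearMap.rTensor_comp_lTensor, ← LinearMap.lTensor_comp_rTensor,
    LinearMap.coe_comp] at h2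
  exact h2.of_comp

/-- An extension of modules with vanishing `Tor₁(-, N)` has vanishing `Tor₁(-, N)`. -/
theorem of_extension {U V W : Type u} [AddCommGroup U] [Module R U] [AddCommGroup V] [Module R V]
    [AddCommGroup W] [Module R W] {f : U →ₗ[R] V} {g : V →ₗ[R] W} (hf : Function.Injective f)
    (hfg : Function.Exact f g) (hg : Function.Surjective g) (hU : TorOneVanishes R U N)
    (hW : TorOneVanishes R W N) : TorOneVanishes R V N := by
  obtain ⟨A, B, i, p, hB, hi, hip, hp⟩ := exists_projective_presentation R N
  refine of_presentation hip hp ?_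
  rw [lTensor_injective_iff_rTensor_injective, injective_iff_map_eq_zero]
  intro x hx
  have h1 : i.rTensor W (g.lTensor _ x) = 0 := by
    rw [← LinearMap.comp_apply, LinearMap.rTensor_comp_lTensor, ← LinearMap.lTensor_comp_rTensor,
      LinearMap.comp_apply, hx, map_zero]
  obtain ⟨y, rfl⟩ := (lTensor_exact _ hfg hg _).1
    ((injective_iff_map_eq_zero _).1 (hW.symm _ _ i p hi hip hp) _ h1)
  have h2 : f.lTensor _ (i.rTensor U y) = 0 := by
    rw [← hx, ← LinearMap.comp_apply, ← LinearMap.comp_apply, LinearMap.lTensor_comp_rTensor,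
      LinearMap.rTensor_comp_lTensor]
  have h3 := (injective_iff_map_eq_zero _).1
    (Module.Flat.lTensor_preserves_injective_linearMap (M := B) f hf) _ h2
  rw [(injective_iff_map_eq_zero _).1 (hU.symm _ _ i p hi hip hp) _ h3, map_zero]

end TorOneVanishes

/-- `N` is flat if `Tor₁(-, N)` vanishes. -/
theorem Module.Flat.of_torOneVanishes {N : Type u} [AddCommGroup N] [Module R N]
    (h : ∀ (X : Type u) [AddCommGroup X] [Module R X], TorOneVanishes R X N) :
    Module.Flat R N := by
  rw [Module.Flat.iff_rTensor_preserves_injective_linearMap]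
  intro A B _ _ _ _ i hi
  exact h (B ⧸ LinearMap.range i) _ _ i (LinearMap.range i).mkQ hi
    (LinearMap.exact_map_mkQ_range i) (Submodule.mkQ_surjective _)

/-- Tensoring with `H` preserves exactness at `B` of an exact sequence `A → B → D → Y` when
`Tor₁(H, -)` vanishes on the image of `D` in `Y`. -/
theorem lTensor_exact_of_torOneVanishes (H : Type u) [AddCommGroup H] [Module R H]
    {A B D Y : Type u} [AddCommGroup A] [Module R A] [AddCommGroup B] [Module R B]
    [AddCommGroup D] [Module R D] [AddCommGroup Y] [Module R Y]
    {f : A →ₗ[R] B} {g : B →ₗ[R] D} {h : D →ₗ[R] Y} (hfg : Function.Exact f g)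
    (hgh : Function.Exact g h) (hH : TorOneVanishes R (LinearMap.range h) H) :
    Function.Exact (f.lTensor H) (g.lTensor H) := by
  have h1 : Function.Exact f g.rangeRestrict := by
    intro x
    rw [← hfg x, Subtype.ext_iff]
    rfl
  have h2 := lTensor_exact H h1 g.surjective_rangeRestrict
  have h3 : Function.Injective ((LinearMap.range g).subtype.lTensor H) := by
    refine hH.lTensor_injective (p := h.rangeRestrict) (Submodule.injective_subtype _) ?_
      h.surjective_rangeRestrict
    intro x
    rw [Subtype.ext_iff]
    refine (hgh x).trans ?_
    simp
  have h4 : g.lTensor H = (LinearMap.range g).subtype.lTensor H ∘ₗ g.rangeRestrict.lTensor H := by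
    rw [← LinearMap.lTensor_comp]
    rfl
  rw [h4]
  exact h2.comp_injective _ h3 (map_zero _)

/-! ### Factoring maps through exact sequences; Ext¹ as an extension problem. -/

theorem Function.Exact.exists_linearMap_lift {A W E E' : Type u} [AddCommGroup A] [Module R A]
    [AddCommGroup W] [Module R W] [AddCommGroup E] [Module R E] [AddCommGroup E'] [Module R E']
    {κ : W →ₗ[R] E} {p : E →ₗ[R] E'} (h : Function.Exact κ p) (hκ : Function.Injective κ)
    (φ : A →ₗ[R] E) (hφ : p ∘ₗ φ = 0) : ∃ u : A →ₗ[R] W, κ ∘ₗ u = φ := by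
  have hr : ∀ a, φ a ∈ LinearMap.range κ := fun a => (h _).1 (LinearMap.congr_fun hφ a)
  refine ⟨(LinearEquiv.ofInjective κ hκ).symm.toLinearMap ∘ₗ φ.codRestrict _ hr, ?_⟩
  ext a
  exact congrArg Subtype.val
    ((LinearEquiv.ofInjective κ hκ).apply_symm_apply (φ.codRestrict _ hr a))

theorem Function.Exact.exists_linearMap_desc {A B M W : Type u} [AddCommGroup A] [Module R A]
    [AddCommGroup B] [Module R B] [AddCommGroup M] [Module R M] [AddCommGroup W] [Module R W]
    {i : A →ₗ[R] B} {e : B →ₗ[R] M} (h : Function.Exact i e) (he : Function.Surjective e)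
    (φ : B →ₗ[R] W) (hφ : φ ∘ₗ i = 0) : ∃ ψ : M →ₗ[R] W, ψ ∘ₗ e = φ := by
  have hk : LinearMap.ker e ≤ LinearMap.ker φ := by
    intro b hb
    obtain ⟨a, rfl⟩ := (h b).1 hb
    exact LinearMap.congr_fun hφ a
  refine ⟨(LinearMap.ker e).liftQ φ hk ∘ₗ (e.quotKerEquivOfSurjective he).symm.toLinearMap, ?_⟩
  ext b
  have : (e.quotKerEquivOfSurjective he).symm (e b) = (LinearMap.ker e).mkQ b := by
    rw [LinearEquiv.symm_apply_eq]
    rfl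
  simp [this]

/-- Every linear map `A → W` extends along `i : A → B`. -/
def ExtendsAlong {A B : Type u} [AddCommGroup A] [Module R A] [AddCommGroup B] [Module R B]
    (i : A →ₗ[R] B) (W : Type u) [AddCommGroup W] [Module R W] : Prop :=
  ∀ u : A →ₗ[R] W, ∃ h : B →ₗ[R] W, h ∘ₗ i = u

namespace ExtendsAlong

variable {A B : Type u} [AddCommGroup A] [Module R A] [AddCommGroup B] [Module R B]
  {i : A →ₗ[R] B}

/-- If `0 → A → B → M → 0` is exact with `B` projective and maps `A → W` extend to `B`, then
maps from `M` lift along surjections with kernel `W`. -/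
theorem exists_lift {M W E E' : Type u} [AddCommGroup M] [Module R M]
    [AddCommGroup W] [Module R W] [AddCommGroup E] [Module R E] [AddCommGroup E'] [Module R E']
    [Module.Projective R B] {e : B →ₗ[R] M} (hie : Function.Exact i e)
    (he : Function.Surjective e) {κ : W →ₗ[R] E} {p : E →ₗ[R] E'} (hκp : Function.Exact κ p)
    (hκ : Function.Injective κ) (hp : Function.Surjective p) (hW : ExtendsAlong i W)
    (v : M →ₗ[R] E') : ∃ v' : M →ₗ[R] E, p ∘ₗ v' = v := by
  obtain ⟨w, hw⟩ := Module.projective_lifting_property p (v ∘ₗ e) hp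
  obtain ⟨u, hu⟩ := hκp.exists_linearMap_lift hκ (w ∘ₗ i) (by
    rw [← LinearMap.comp_assoc, hw, LinearMap.comp_assoc, hie.linearMap_comp_eq_zero,
      LinearMap.comp_zero])
  obtain ⟨h, hh⟩ := hW u
  obtain ⟨v', hv'⟩ := hie.exists_linearMap_desc he (w - κ ∘ₗ h) (by
    rw [LinearMap.sub_comp, LinearMap.comp_assoc, hh, hu, sub_self])
  refine ⟨v', ?_⟩
  rw [← LinearMap.cancel_right he, LinearMap.comp_assoc, hv', LinearMap.comp_sub, hw,
    ← LinearMap.comp_assoc, hκp.linearMap_comp_eq_zero, LinearMap.zero_comp, sub_zero]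

theorem of_retract {W W' : Type u} [AddCommGroup W] [Module R W] [AddCommGroup W'] [Module R W']
    (h : ExtendsAlong i W) (s : W' →ₗ[R] W) (r : W →ₗ[R] W') (hrs : r ∘ₗ s = LinearMap.id) :
    ExtendsAlong i W' := by
  intro u
  obtain ⟨g, hg⟩ := h (s ∘ₗ u)
  exact ⟨r ∘ₗ g, by rw [LinearMap.comp_assoc, hg, ← LinearMap.comp_assoc, hrs, LinearMap.id_comp]⟩

theorem pi {J W : Type u} [AddCommGroup W] [Module R W] (h : ExtendsAlong i W) :
    ExtendsAlong i (J → W) := by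
  intro u
  choose g hg using fun j => h (LinearMap.proj j ∘ₗ u)
  refine ⟨LinearMap.pi g, ?_⟩
  ext a j
  exact LinearMap.congr_fun (hg j) a

end ExtendsAlong

/-- A linear map from a finite module to `J →₀ W` has uniformly finite support. -/
theorem exists_finset_support_subset {A J W : Type u} [AddCommGroup A] [Module R A]
    [AddCommGroup W] [Module R W] [Module.Finite R A] (u : A →ₗ[R] J →₀ W) :
    ∃ s : Finset J, ∀ a, (u a).support ⊆ s := by
  classical
  obtain ⟨t, ht⟩ := Module.Finite.fg_top (R := R) (M := A)
  refine ⟨t.biUnion fun a => (u a).support, fun a => ?_⟩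
  have ha : a ∈ Submodule.span R (t : Set A) := ht ▸ Submodule.mem_top
  induction ha using Submodule.span_induction with
  | mem x hx => exact Finset.subset_biUnion_of_mem (fun a => (u a).support) hx
  | zero => simp
  | add x y _ _ hx hy =>
    rw [map_add]
    exact Finsupp.support_add.trans (Finset.union_subset hx hy)
  | smul r x _ hx =>
    rw [map_smul]
    exact Finsupp.support_smul.trans hx

/-- Because `A` is finite, only finitely many coordinates of the map are nonzero, so the
coordinatewise extensions can be summed. -/
theorem ExtendsAlong.finsupp {A B J W : Type u} [AddCommGroup A] [Module R A] [AddCommGroup B]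
    [Module R B] {i : A →ₗ[R] B} [AddCommGroup W] [Module R W] [Module.Finite R A]
    (h : ExtendsAlong i W) : ExtendsAlong i (J →₀ W) := by
  intro u
  obtain ⟨s, hs⟩ := exists_finset_support_subset u
  choose g hg using fun j => h (Finsupp.lapply j ∘ₗ u)
  refine ⟨∑ j ∈ s, Finsupp.lsingle j ∘ₗ g j, ?_⟩
  ext a j
  have hg' : ∀ k, g k (i a) = u a k := fun k => LinearMap.congr_fun (hg k) a
  simp only [LinearMap.comp_apply, LinearMap.sum_apply, Finsupp.finsetSum_apply,
    Finsupp.lsingle_apply, hg']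
  classical
  simp only [Finsupp.single_apply]
  rw [Finset.sum_ite_eq']
  split_ifs with hj
  · rfl
  · exact (Finsupp.notMem_support_iff.1 fun hmem => hj (hs a hmem)).symm

/-- For `P` projective, `C ⊗ P` is a retract of a direct sum of copies of `C`. -/
theorem exists_retract_finsupp (C P : Type u) [AddCommGroup C] [Module R C] [AddCommGroup P]
    [Module R P] [Module.Projective R P] :
    ∃ (s : C ⊗[R] P →ₗ[R] P →₀ C) (r : (P →₀ C) →ₗ[R] C ⊗[R] P), r ∘ₗ s = LinearMap.id := by
  classical
  obtain ⟨σ, hσ⟩ := Module.projective_def'.1 (inferInstance : Module.Projective R P)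
  refine ⟨(TensorProduct.finsuppScalarRight R R C P).toLinearMap ∘ₗ σ.lTensor C,
    (Finsupp.linearCombination R id).lTensor C ∘ₗ
      (TensorProduct.finsuppScalarRight R R C P).symm.toLinearMap, ?_⟩
  ext c p
  have := LinearMap.congr_fun hσ p
  simp at this
  simp [this]

/-- A presentation of `C` witnessing that `C` is of type `FP₂` and `Ext¹(C, C) = 0`. -/
theorem IsSemidualizing.exists_presentation {C : Type u} [AddCommGroup C] [Module R C]
    (hC : IsSemidualizing R C) :
    ∃ (A B : ModuleCat.{u} R) (i : A →ₗ[R] B) (e : B →ₗ[R] C),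
      Module.FinitePresentation R A ∧ Module.Finite R B ∧ Module.Projective R B ∧
      Function.Injective i ∧ Function.Exact i e ∧ Function.Surjective e ∧ ExtendsAlong i C := by
  obtain ⟨P, d, ε, hP, hε, h0, h1⟩ := hC.resolution
  have := fun n => (hP n).1
  have := fun n => (hP n).2
  let A := ModuleCat.of R (LinearMap.ker ε)
  let i : A →ₗ[R] P 0 := (LinearMap.ker ε).subtype
  have hi : Function.Injective i := Submodule.injective_subtype _
  have hie : Function.Exact i ε := LinearMap.exact_subtype_ker_map ε
  refine ⟨A, P 0, i, ε, ?_, inferInstance, inferInstance, hi, hie, hε, ?_⟩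
  · obtain ⟨q, hq⟩ := hie.exists_linearMap_lift hi (d 0) h0.linearMap_comp_eq_zero
    have hqs : Function.Surjective q := by
      intro a
      obtain ⟨x, hx⟩ := (h0 (i a)).1 ((hie _).2 ⟨a, rfl⟩)
      exact ⟨x, hi (by rw [← hx, ← hq]; rfl)⟩
    have := Module.finitePresentation_of_projective R (P 1)
    refine Module.finitePresentation_of_surjective q hqs ?_
    -- The relations among the generators of `A` coming from `P 1` are the image of the finite
    -- module `P 2`.
    have hk : LinearMap.ker q = LinearMap.range (d 1) := by
      rw [← (h1 0).linearMap_ker_eq, ← hq, LinearMap.ker_comp_of_ker_eq_bot _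
        (LinearMap.ker_eq_bot.2 hi)]
    rw [hk]
    exact Submodule.FG.of_finite
  · intro u
    let S : CategoryTheory.ShortComplex (ModuleCat.{u} R) :=
      CategoryTheory.ShortComplex.mk (ModuleCat.ofHom i) (X₃ := ModuleCat.of R C)
        (ModuleCat.ofHom ε)
        (by ext x; exact (hie _).2 ⟨x, rfl⟩)
    have hS : S.ShortExact := ModuleCat.shortComplex_shortExact S hie hi hε
    have := hC.ext_eq_zero 1 le_rfl
    -- The obstruction to extending `u` is its image under the connecting map, an element of Ext¹(C,
    -- C) = 0.
    obtain ⟨x, hx⟩ := CategoryTheory.Abelian.Ext.contravariant_sequence_exact₁ hS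
      (ModuleCat.of R C) (CategoryTheory.Abelian.Ext.mk₀ (ModuleCat.ofHom u))
      (n₁ := 1) rfl (Subsingleton.elim (α := CategoryTheory.Abelian.Ext
        (ModuleCat.of R C) (ModuleCat.of R C) 1) _ _)
    obtain ⟨h, rfl⟩ := (CategoryTheory.Abelian.Ext.mk₀_bijective _ _).2 x
    rw [CategoryTheory.Abelian.Ext.mk₀_comp_mk₀] at hx
    have := (CategoryTheory.Abelian.Ext.mk₀_bijective _ _).1 hx
    exact ⟨h.hom, congrArg ModuleCat.Hom.hom this⟩

/-! ### Full faithfulness of `C ⊗ -` on projective modules. -/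

namespace IsSemidualizing

variable {C : Type u} [AddCommGroup C] [Module R C]

theorem finite (hC : IsSemidualizing R C) : Module.Finite R C := by
  obtain ⟨A, B, i, e, _, _, _, _, _, he, _⟩ := hC.exists_presentation
  exact Module.Finite.of_surjective e he

/-- For `P` projective the unit `P → Hom(C, C ⊗ P)` is injective. -/
theorem mk_flip_injective (hC : IsSemidualizing R C) (P : Type u) [AddCommGroup P] [Module R P]
    [Module.Projective R P] :
    Function.Injective (TensorProduct.mk R C P).flip := by
  classical
  obtain ⟨σ, hσ⟩ := Module.projective_def'.1 (inferInstance : Module.Projective R P)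
  rw [injective_iff_map_eq_zero]
  intro p hp
  have h1 : σ p = 0 := by
    ext x
    apply hC.homothety.1
    ext c
    have h2 : c ⊗ₜ[R] p = 0 := LinearMap.congr_fun hp c
    have h3 := congrArg (fun t => TensorProduct.finsuppScalarRight R R C P (σ.lTensor C t) x) h2
    simpa using h3
  have := LinearMap.congr_fun hσ p
  rw [LinearMap.comp_apply, h1, map_zero] at this
  exact this.symm

/-- For `P` projective the unit `P → Hom(C, C ⊗ P)` is surjective. -/
theorem mk_flip_surjective (hC : IsSemidualizing R C) (P : Type u) [AddCommGroup P] [Module R P]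
    [Module.Projective R P] :
    Function.Surjective (TensorProduct.mk R C P).flip := by
  have := hC.finite
  classical
  obtain ⟨σ, hσ⟩ := Module.projective_def'.1 (inferInstance : Module.Projective R P)
  intro v
  let w : C →ₗ[R] P →₀ C :=
    (TensorProduct.finsuppScalarRight R R C P).toLinearMap ∘ₗ σ.lTensor C ∘ₗ v
  obtain ⟨s, hs⟩ := exists_finset_support_subset w
  choose r hr using fun x => hC.homothety.2 (Finsupp.lapply x ∘ₗ w)
  have hr' : ∀ x c, r x • c = w c x := fun x c => LinearMap.congr_fun (hr x) c
  have hw : ∀ c, w c = TensorProduct.finsuppScalarRight R R C P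
      (c ⊗ₜ (∑ x ∈ s, Finsupp.single x (r x))) := by
    intro c
    ext x
    rw [TensorProduct.finsuppScalarRight_apply_tmul_apply, Finsupp.finsetSum_apply]
    simp only [Finsupp.single_apply]
    rw [Finset.sum_ite_eq']
    split_ifs with hx
    · exact (hr' x c).symm
    · rw [zero_smul]
      exact Finsupp.notMem_support_iff.1 fun h' => hx (hs c h')
  refine ⟨Finsupp.linearCombination R id (∑ x ∈ s, Finsupp.single x (r x)), ?_⟩
  ext c
  have h1 := (TensorProduct.finsuppScalarRight R R C P).injective (hw c)
  have h2 := congrArg ((Finsupp.linearCombination R (id : P → P)).lTensor C) h1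
  rw [LinearMap.comp_apply, ← LinearMap.lTensor_comp_apply, hσ, LinearMap.lTensor_id] at h2
  exact h2.symm

/-- Every map `C ⊗ P → C ⊗ Q` with `Q` projective is induced by a map `P → Q`. -/
theorem exists_lTensor_eq (hC : IsSemidualizing R C) {P Q : Type u} [AddCommGroup P]
    [Module R P] [AddCommGroup Q] [Module R Q] [Module.Projective R Q] (g : C ⊗[R] P →ₗ[R] C ⊗[R] Q) :
    ∃ f : P →ₗ[R] Q, f.lTensor C = g := by
  let η := LinearEquiv.ofBijective (TensorProduct.mk R C Q).flip
    ⟨hC.mk_flip_injective Q, hC.mk_flip_surjective Q⟩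
  refine ⟨η.symm.toLinearMap ∘ₗ LinearMap.llcomp R C _ _ g ∘ₗ (TensorProduct.mk R C P).flip, ?_⟩
  ext c p
  exact LinearMap.congr_fun
    (η.apply_symm_apply (g ∘ₗ (TensorProduct.mk R C P).flip p)) c

end IsSemidualizing

theorem IsCProjective.isCFlat {C N : Type u} [AddCommGroup C] [Module R C] [AddCommGroup N]
    [Module R N] (h : IsCProjective R C N) : IsCFlat R C N := by
  obtain ⟨P, hP, e⟩ := h
  exact ⟨P, inferInstance, e⟩

theorem IsCProjective.prod {C N N₂ : Type u} [AddCommGroup C] [Module R C] [AddCommGroup N]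
    [Module R N] [AddCommGroup N₂] [Module R N₂] (h : IsCProjective R C N)
    (h₂ : IsCProjective R C N₂) : IsCProjective R C (N × N₂) := by
  obtain ⟨P, hP, ⟨e⟩⟩ := h
  obtain ⟨P₂, hP₂, ⟨e₂⟩⟩ := h₂
  exact ⟨ModuleCat.of R (P × P₂), inferInstanceAs (Module.Projective R (P × P₂)),
    ⟨(e.prodCongr e₂).trans (TensorProduct.prodRight R R C P P₂).symm⟩⟩

/-! ### Proper coresolutions and the mapping cone embedding. -/

/-- A coresolution `0 → M → K 0 → K 1 → ⋯` by `C`-projective modules which stays exact under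
`Hom(-, W)` for every `C`-projective module `W`. -/
structure ProperCoresolution (R : Type u) [CommRing R] (C : Type u) [AddCommGroup C] [Module R C]
    (M : Type u) [AddCommGroup M] [Module R M] where
  K : ℕ → ModuleCat.{u} R
  a : M →ₗ[R] K 0
  d : ∀ n, K n →ₗ[R] K (n + 1)
  isCProjective : ∀ n, IsCProjective R C (K n)
  injective : Function.Injective a
  exact_zero : Function.Exact a (d 0)
  exact_succ : ∀ n, Function.Exact (d n) (d (n + 1))
  extendsAlong : ∀ (W : ModuleCat.{u} R), IsCProjective R C W → ExtendsAlong a W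
  desc_zero : ∀ (W : ModuleCat.{u} R), IsCProjective R C W → ∀ φ : K 0 →ₗ[R] W, φ ∘ₗ a = 0 →
    ∃ ψ : K 1 →ₗ[R] W, ψ ∘ₗ d 0 = φ
  desc_succ : ∀ (W : ModuleCat.{u} R), IsCProjective R C W → ∀ n, ∀ φ : K (n + 1) →ₗ[R] W,
    φ ∘ₗ d n = 0 → ∃ ψ : K (n + 2) →ₗ[R] W, ψ ∘ₗ d (n + 1) = φ

theorem TwoSidedSeq.IsHomExact.congr {X : TwoSidedSeq R} {W W' : Type u} [AddCommGroup W]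
    [Module R W] [AddCommGroup W'] [Module R W'] (h : X.IsHomExact W) (e : W' ≃ₗ[R] W) :
    X.IsHomExact W' := by
  have key : ∀ {A B D : Type u} [AddCommGroup A] [Module R A] [AddCommGroup B] [Module R B]
      [AddCommGroup D] [Module R D] (f : A →ₗ[R] B) (g : B →ₗ[R] D),
      Function.Exact (g.lcomp R W) (f.lcomp R W) →
        Function.Exact (g.lcomp R W') (f.lcomp R W') := by
    intro A B D _ _ _ _ _ _ f g hfg φ
    constructor
    · intro hφ
      obtain ⟨ψ, hψ⟩ := (hfg (e.toLinearMap ∘ₗ φ)).1 (by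
        ext x
        simpa using LinearMap.congr_fun hφ x)
      refine ⟨e.symm.toLinearMap ∘ₗ ψ, ?_⟩
      ext x
      have := LinearMap.congr_fun hψ x
      simp only [LinearMap.lcomp_apply', LinearMap.comp_apply, LinearEquiv.coe_coe] at this ⊢
      rw [this, e.symm_apply_apply]
    · rintro ⟨ψ, rfl⟩
      have := (hfg (g.lcomp R W (e.toLinearMap ∘ₗ ψ))).2 ⟨_, rfl⟩
      ext x
      simpa using LinearMap.congr_fun this x
  exact ⟨fun n => key _ _ (h.left n), key _ _ h.midLeft, key _ _ h.midRight,
    fun n => key _ _ (h.right n)⟩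

/-- The right half of the defining sequence serves. Extension along `a` is Hom-exactness at `X.L 0`:
composed with the surjection onto `M`, a map to `W` kills the image of `X.dL 0` and so factors
through `X.mid`. -/
theorem IsGCProjective.nonempty_properCoresolution {C M : Type u} [AddCommGroup C] [Module R C]
    [AddCommGroup M] [Module R M] (h : IsGCProjective R C M) :
    Nonempty (ProperCoresolution R C M) := by
  obtain ⟨X, -, hK, hX, ⟨e⟩, hW⟩ := h
  have hW' : ∀ W : ModuleCat.{u} R, IsCProjective R C W → X.IsHomExact W := by
    rintro W ⟨P, hP, ⟨e'⟩⟩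
    exact (hW P hP).congr e'
  let a : M →ₗ[R] X.K 0 := (LinearMap.range X.mid).subtype ∘ₗ e.toLinearMap
  let q : X.L 0 →ₗ[R] M := e.symm.toLinearMap ∘ₗ X.mid.rangeRestrict
  have haq : a ∘ₗ q = X.mid := by
    ext x
    simp [a, q]
  have hq : Function.Surjective q := e.symm.surjective.comp X.mid.surjective_rangeRestrict
  have ha : Function.Injective a := (Submodule.injective_subtype _).comp e.injective
  refine ⟨⟨X.K, a, X.dK, hK, ha, ?_, hX.right, ?_, ?_, ?_⟩⟩
  · intro y
    rw [hX.midRight y]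
    constructor
    · rintro ⟨x, rfl⟩
      exact ⟨q x, LinearMap.congr_fun haq x⟩
    · rintro ⟨m, rfl⟩
      obtain ⟨x, rfl⟩ := hq m
      exact ⟨x, (LinearMap.congr_fun haq x).symm⟩
  · intro W hW u
    obtain ⟨ψ, hψ⟩ := ((hW' W hW).midLeft (u ∘ₗ q)).1 (by
      ext x
      have h1 : q (X.dL 0 x) = 0 := ha (by
        rw [map_zero, ← LinearMap.comp_apply, haq]
        exact (hX.midLeft _).2 ⟨x, rfl⟩)
      simp [h1])
    refine ⟨ψ, ?_⟩
    rw [← LinearMap.cancel_right hq, ← hψ, LinearMap.comp_assoc, haq]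
    rfl
  · intro W hW φ hφ
    obtain ⟨ψ, hψ⟩ := ((hW' W hW).midRight φ).1 (by
      rw [LinearMap.lcomp_apply', ← haq, ← LinearMap.comp_assoc, hφ, LinearMap.zero_comp])
    exact ⟨ψ, hψ⟩
  · intro W hW n φ hφ
    obtain ⟨ψ, hψ⟩ := ((hW' W hW).right n φ).1 hφ
    exact ⟨ψ, hψ⟩

/-- A map between modules with proper coresolutions lifts to the coresolutions. -/
theorem ProperCoresolution.exists_lift {C M M' : Type u} [AddCommGroup C] [Module R C]
    [AddCommGroup M] [Module R M] [AddCommGroup M'] [Module R M']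
    (X : ProperCoresolution R C M) (Y : ProperCoresolution R C M') (i : M →ₗ[R] M') :
    ∃ e : ∀ n, X.K n →ₗ[R] Y.K n, e 0 ∘ₗ X.a = Y.a ∘ₗ i ∧
      ∀ n, e (n + 1) ∘ₗ X.d n = Y.d n ∘ₗ e n := by
  obtain ⟨e0, he0⟩ := X.extendsAlong _ (Y.isCProjective 0) (Y.a ∘ₗ i)
  obtain ⟨e1, he1⟩ := X.desc_zero _ (Y.isCProjective 1) (Y.d 0 ∘ₗ e0) (by
    rw [LinearMap.comp_assoc, he0, ← LinearMap.comp_assoc, Y.exact_zero.linearMap_comp_eq_zero,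
      LinearMap.zero_comp])
  -- The next map exists only because the previous square commutes, so the recursion carries two
  -- consecutive maps together with their square.
  let S : ℕ → Type u := fun n =>
    {p : (X.K n →ₗ[R] Y.K n) × (X.K (n + 1) →ₗ[R] Y.K (n + 1)) // p.2 ∘ₗ X.d n = Y.d n ∘ₗ p.1}
  have next : ∀ n (p : S n), ∃ p' : S (n + 1), p'.1.1 = p.1.2 := by
    rintro n ⟨⟨f, g⟩, hfg⟩
    obtain ⟨g', hg'⟩ := X.desc_succ _ (Y.isCProjective (n + 2)) n (Y.d (n + 1) ∘ₗ g) (by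
      rw [LinearMap.comp_assoc, hfg, ← LinearMap.comp_assoc,
        (Y.exact_succ n).linearMap_comp_eq_zero, LinearMap.zero_comp])
    exact ⟨⟨⟨g, g'⟩, hg'⟩, rfl⟩
  choose nx hnx using next
  let s : ∀ n, S n := fun n => Nat.rec ⟨⟨e0, e1⟩, he1⟩ nx n
  refine ⟨fun n => (s n).1.1, he0, fun n => ?_⟩
  have h1 : (s (n + 1)).1.1 = (s n).1.2 := hnx n (s n)
  beta_reduce
  rw [h1]
  exact (s n).2

/-- An exact sequence `0 → M → C ⊗ T → K 0 → K 1 → ⋯` where the `K n` are `C`-projective and `T`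
has a projective presentation `P → Q → T → 0` with `C ⊗ P → C ⊗ Q` injective. -/
structure CEmbedding (R : Type u) [CommRing R] (C : Type u) [AddCommGroup C] [Module R C]
    (M : Type u) [AddCommGroup M] [Module R M] where
  P : ModuleCat.{u} R
  Q : ModuleCat.{u} R
  T : ModuleCat.{u} R
  K : ℕ → ModuleCat.{u} R
  f : P →ₗ[R] Q
  g : Q →ₗ[R] T
  ι : M →ₗ[R] C ⊗[R] T
  δ : C ⊗[R] T →ₗ[R] K 0
  d : ∀ n, K n →ₗ[R] K (n + 1)
  projective_P : Module.Projective R P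
  projective_Q : Module.Projective R Q
  isCProjective : ∀ n, IsCProjective R C (K n)
  lTensor_injective : Function.Injective (f.lTensor C)
  exact_f_g : Function.Exact f g
  surjective_g : Function.Surjective g
  injective_ι : Function.Injective ι
  exact_ι_δ : Function.Exact ι δ
  exact_δ_d : Function.Exact δ (d 0)
  exact_d : ∀ n, Function.Exact (d n) (d (n + 1))

/-- The embedding of a module obtained as the mapping cone of a lift of `A → B` to proper
coresolutions, where `0 → A → B → M → 0` is exact. -/
theorem ProperCoresolution.nonempty_cEmbedding {C A B M : Type u} [AddCommGroup C] [Module R C]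
    [AddCommGroup A] [Module R A] [AddCommGroup B] [Module R B] [AddCommGroup M] [Module R M]
    (hC : IsSemidualizing R C) (X : ProperCoresolution R C A) (Y : ProperCoresolution R C B)
    {i : A →ₗ[R] B} {p : B →ₗ[R] M} (hi : Function.Injective i) (hip : Function.Exact i p)
    (hp : Function.Surjective p) : Nonempty (CEmbedding R C M) := by
  obtain ⟨e, he0, he⟩ := X.exists_lift Y i
  replace he0 : ∀ x, e 0 (X.a x) = Y.a (i x) := LinearMap.congr_fun he0
  replace he : ∀ n x, e (n + 1) (X.d n x) = Y.d n (e n x) := fun n => LinearMap.congr_fun (he n)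
  have hXd : ∀ n x, X.d (n + 1) (X.d n x) = 0 := fun n x => (X.exact_succ n _).2 ⟨x, rfl⟩
  have hYd : ∀ n x, Y.d (n + 1) (Y.d n x) = 0 := fun n x => (Y.exact_succ n _).2 ⟨x, rfl⟩
  have hXa : ∀ x, X.d 0 (X.a x) = 0 := fun x => (X.exact_zero _).2 ⟨x, rfl⟩
  have hYa : ∀ x, Y.d 0 (Y.a x) = 0 := fun x => (Y.exact_zero _).2 ⟨x, rfl⟩
  -- These are the cone differentials; the minus sign makes consecutive ones compose to zero. The
  -- copy of `B` sits in the same term as the target of `κ`.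
  let κ : X.K 0 →ₗ[R] Y.K 0 × X.K 1 := (e 0).prod (-X.d 0)
  let D : ∀ n, (Y.K n × X.K (n + 1)) →ₗ[R] (Y.K (n + 1) × X.K (n + 2)) := fun n =>
    ((Y.d n).coprod (e (n + 1))).prod (-X.d (n + 1) ∘ₗ LinearMap.snd R _ _)
  let j : B →ₗ[R] Y.K 0 × X.K 1 := LinearMap.inl R _ _ ∘ₗ Y.a
  have hκ_apply : ∀ x, κ x = (e 0 x, -X.d 0 x) := fun x => rfl
  have hD_apply : ∀ n x, D n x = (Y.d n x.1 + e (n + 1) x.2, -X.d (n + 1) x.2) :=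
    fun n x => rfl
  have hj_apply : ∀ x, j x = (Y.a x, 0) := fun x => rfl
  have hκ : Function.Injective κ := by
    rw [injective_iff_map_eq_zero]
    intro k hk
    rw [hκ_apply, Prod.mk_eq_zero, neg_eq_zero] at hk
    obtain ⟨x, rfl⟩ := (X.exact_zero k).1 hk.2
    rw [he0] at hk
    rw [hi (Y.injective (hk.1.trans ((map_zero (Y.a ∘ₗ i)).symm))), map_zero]
  have hDκ : ∀ x, D 0 (κ x) = 0 := by
    intro x
    simp [hκ_apply, hD_apply, he, hXd]
  have hDj : ∀ x, D 0 (j x) = 0 := by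
    intro x
    simp [hj_apply, hD_apply, hYa]
  have hjκ : ∀ x, j (i x) = κ (X.a x) := by
    intro x
    simp [hj_apply, hκ_apply, he0, hXa]
  -- The kernel of `D 0` is `j(B) + im κ`, and by `hjr` an element of `B` whose image under `j` lies
  -- in `im κ` comes from `A`. Hence the homology here is `B / A`, that is `M`.
  have hD0 : ∀ y, D 0 y = 0 → ∃ x k, y = j x + κ k := by
    rintro ⟨l, k⟩ h
    rw [hD_apply, Prod.mk_eq_zero, neg_eq_zero] at h
    obtain ⟨k0, rfl⟩ := (X.exact_succ 0 k).1 h.2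
    obtain ⟨x, hx⟩ := (Y.exact_zero (l + e 0 k0)).1 (by rw [map_add, ← he]; exact h.1)
    refine ⟨x, -k0, ?_⟩
    simp [hj_apply, hκ_apply, hx]
  have hjr : ∀ x k, j x = κ k → ∃ y, i y = x := by
    intro x k h
    rw [hj_apply, hκ_apply, Prod.mk.injEq] at h
    obtain ⟨y, rfl⟩ := (X.exact_zero k).1 (neg_eq_zero.1 h.2.symm)
    exact ⟨y, Y.injective (by rw [← he0, h.1])⟩
  have hDexact : ∀ n, Function.Exact (D n) (D (n + 1)) := by
    intro n
    rintro ⟨l, k⟩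
    constructor
    · intro h
      rw [hD_apply, Prod.mk_eq_zero, neg_eq_zero] at h
      obtain ⟨k', rfl⟩ := (X.exact_succ (n + 1) k).1 h.2
      obtain ⟨l', hl'⟩ := (Y.exact_succ n (l + e (n + 1) k')).1 (by
        rw [map_add, ← he]; exact h.1)
      refine ⟨(l', -k'), ?_⟩
      simp [hD_apply, hl']
    · rintro ⟨y, hy⟩
      rw [← hy]
      simp [hD_apply, he, hXd, hYd]
  obtain ⟨P, hP, ⟨eP⟩⟩ := X.isCProjective 0
  obtain ⟨Q, hQ, ⟨eQ⟩⟩ := (Y.isCProjective 0).prod (X.isCProjective 1)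
  obtain ⟨f, hf⟩ := hC.exists_lTensor_eq (eQ.toLinearMap ∘ₗ κ ∘ₗ eP.symm.toLinearMap)
  let T := ModuleCat.of R (Q ⧸ LinearMap.range f)
  let g : Q →ₗ[R] T := (LinearMap.range f).mkQ
  have hg : Function.Surjective g := Submodule.mkQ_surjective _
  have hfg : Function.Exact f g := LinearMap.exact_map_mkQ_range f
  let q : (Y.K 0 × X.K 1) →ₗ[R] C ⊗[R] T := g.lTensor C ∘ₗ eQ.toLinearMap
  have hq : Function.Surjective q := (LinearMap.lTensor_surjective C hg).comp eQ.surjective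
  have hκq : Function.Exact κ q := by
    intro y
    refine (lTensor_exact C hfg hg (eQ y)).trans ?_
    rw [hf]
    constructor
    · rintro ⟨z, hz⟩
      exact ⟨eP.symm z, eQ.injective hz⟩
    · rintro ⟨x, rfl⟩
      exact ⟨eP x, by simp⟩
  obtain ⟨ι, hι⟩ := hip.exists_linearMap_desc hp (q ∘ₗ j) (by
    ext x
    exact (congrArg q (hjκ x)).trans ((hκq _).2 ⟨_, rfl⟩))
  obtain ⟨δ, hδ⟩ := hκq.exists_linearMap_desc hq (D 0) (LinearMap.ext hDκ)
  replace hι : ∀ x, ι (p x) = q (j x) := LinearMap.congr_fun hι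
  replace hδ : ∀ x, δ (q x) = D 0 x := LinearMap.congr_fun hδ
  refine ⟨⟨P, Q, T, fun n => ModuleCat.of R (Y.K (n + 1) × X.K (n + 2)), f, g, ι, δ,
    fun n => D (n + 1), hP, hQ, fun n => (Y.isCProjective (n + 1)).prod (X.isCProjective (n + 2)),
    ?_, hfg, hg, ?_, ?_, ?_, fun n => hDexact (n + 1)⟩⟩
  · rw [hf]
    exact eQ.injective.comp (hκ.comp eP.symm.injective)
  · rw [injective_iff_map_eq_zero]
    intro m hm
    obtain ⟨x, rfl⟩ := hp m
    rw [hι] at hm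
    obtain ⟨k, hk⟩ := (hκq _).1 hm
    obtain ⟨y, rfl⟩ := hjr x k hk.symm
    exact (hip _).2 ⟨y, rfl⟩
  · intro t
    obtain ⟨y, rfl⟩ := hq t
    constructor
    · intro h
      rw [hδ] at h
      obtain ⟨x, k, rfl⟩ := hD0 y h
      refine ⟨p x, ?_⟩
      rw [hι, map_add, (hκq _).2 ⟨k, rfl⟩, add_zero]
    · rintro ⟨m, hm⟩
      obtain ⟨x, rfl⟩ := hp m
      rw [← hm, hι, hδ, hDj]
  · intro y
    refine (hDexact 0 y).trans ?_
    constructor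
    · rintro ⟨x, rfl⟩
      exact ⟨q x, hδ x⟩
    · rintro ⟨t, rfl⟩
      obtain ⟨x, rfl⟩ := hq t
      exact ⟨x, (hδ x).symm⟩

theorem IsGCProjective.of_equiv {C M M' : Type u} [AddCommGroup C] [Module R C]
    [AddCommGroup M] [Module R M] [AddCommGroup M'] [Module R M'] (h : IsGCProjective R C M)
    (e : M' ≃ₗ[R] M) : IsGCProjective R C M' := by
  obtain ⟨X, h1, h2, h3, ⟨e₂⟩, h4⟩ := h
  exact ⟨X, h1, h2, h3, ⟨e.trans e₂⟩, h4⟩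

/-- Over a `C`-Gorenstein hereditary ring, modules which embed in a projective module are
`G_C`-projective. -/
theorem IsGCHereditary.of_injective {C A B : Type u} [AddCommGroup C] [Module R C]
    [AddCommGroup A] [Module R A] [AddCommGroup B] [Module R B] [Module.Projective R B]
    (hR : IsGCHereditary R C) {i : A →ₗ[R] B} (hi : Function.Injective i) :
    IsGCProjective R C A :=
  (hR B inferInstance (LinearMap.range i)).of_equiv (LinearEquiv.ofInjective i hi)

theorem IsGCHereditary.nonempty_cEmbedding {C : Type u} [AddCommGroup C] [Module R C]
    (hC : IsSemidualizing R C) (hR : IsGCHereditary R C) (M : Type u) [AddCommGroup M]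
    [Module R M] : Nonempty (CEmbedding R C M) := by
  obtain ⟨A, B, i, p, hB, hi, hip, hp⟩ := exists_projective_presentation R M
  obtain ⟨X⟩ := (hR.of_injective hi).nonempty_properCoresolution
  obtain ⟨Y⟩ := (hR.of_injective (i := (LinearMap.id : B →ₗ[R] B))
    Function.injective_id).nonempty_properCoresolution
  exact X.nonempty_cEmbedding hC Y hi hip hp

/-! ### Tor₁ against `T`, and the retraction onto Hom(C, I). -/

/-- `Y ⊗ P` embeds in `Z ⊗ P` by flatness of `P`, so injectivity of `f` after tensoring descends to
submodules. -/
theorem lTensor_injective_of_injective {Y Z P Q : Type u} [AddCommGroup Y] [Module R Y]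
    [AddCommGroup Z] [Module R Z] [AddCommGroup P] [Module R P] [AddCommGroup Q] [Module R Q]
    [Module.Flat R P] {k : Y →ₗ[R] Z} (hk : Function.Injective k) {f : P →ₗ[R] Q}
    (hf : Function.Injective (f.lTensor Z)) : Function.Injective (f.lTensor Y) := by
  have h := hf.comp (Module.Flat.rTensor_preserves_injective_linearMap (M := P) k hk)
  rw [← LinearMap.coe_comp, LinearMap.lTensor_comp_rTensor, ← LinearMap.rTensor_comp_lTensor,
    LinearMap.coe_comp] at h
  exact h.of_comp

theorem lTensor_tensorProduct_injective {C P Q : Type u} (F : Type u) [AddCommGroup C]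
    [Module R C] [AddCommGroup P] [Module R P] [AddCommGroup Q] [Module R Q] [AddCommGroup F]
    [Module R F] {f : P →ₗ[R] Q} (h : Function.Injective ((f.lTensor C).lTensor F)) :
    Function.Injective (f.lTensor (F ⊗[R] C)) := by
  rw [LinearMap.lTensor_tensor]
  simpa using h

namespace CEmbedding

variable {C M : Type u} [AddCommGroup C] [Module R C] [AddCommGroup M] [Module R M]

/-- If `f x = 0` then `c ⊗ x = 0` for all `c`, and the unit at the projective module `P` is
injective. -/
theorem injective_f (hC : IsSemidualizing R C) (E : CEmbedding R C M) :
    Function.Injective E.f := by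
  have := E.projective_P
  rw [injective_iff_map_eq_zero]
  intro x hx
  apply hC.mk_flip_injective
  ext c
  apply E.lTensor_injective
  simp [hx]

/-- `Tor₁(Y, E.T)` vanishes if `Y` embeds in a flat module. -/
theorem torOneVanishes_of_flat (hC : IsSemidualizing R C) (E : CEmbedding R C M) {Y F : Type u}
    [AddCommGroup Y] [Module R Y] [AddCommGroup F] [Module R F] [Module.Flat R F]
    {k : Y →ₗ[R] F} (hk : Function.Injective k) : TorOneVanishes R Y E.T := by
  have := E.projective_P
  have := E.projective_Q
  exact .of_presentation E.exact_f_g E.surjective_g (lTensor_injective_of_injective hk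
    (Module.Flat.lTensor_preserves_injective_linearMap _ (E.injective_f hC)))

/-- `Tor₁(Y, E.T)` vanishes if `Y` embeds in a module `C ⊗ F` with `F` flat. -/
theorem torOneVanishes_of_isCFlat (E : CEmbedding R C M) {Y Z : Type u}
    [AddCommGroup Y] [Module R Y] [AddCommGroup Z] [Module R Z] (hZ : IsCFlat R C Z)
    {k : Y →ₗ[R] Z} (hk : Function.Injective k) : TorOneVanishes R Y E.T := by
  have := E.projective_P
  have := E.projective_Q
  obtain ⟨F, hF, ⟨e⟩⟩ := hZ
  refine .of_presentation E.exact_f_g E.surjective_g (lTensor_injective_of_injective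
    (k := (e.trans (TensorProduct.comm R C F)).toLinearMap ∘ₗ k)
    ((e.trans (TensorProduct.comm R C F)).injective.comp hk)
    (lTensor_tensorProduct_injective _ ?_))
  exact Module.Flat.lTensor_preserves_injective_linearMap _ E.lTensor_injective

/-- Compare 0 → P → Q → T → 0 with Hom(C, -) of its tensor product with `C`: the units at `P` and
`Q` are bijective, and the second sequence stays right exact because Ext¹(C, C ⊗ P) = 0. -/
theorem mk_flip_bijective (hC : IsSemidualizing R C) (E : CEmbedding R C M) :
    Function.Bijective (TensorProduct.mk R C E.T).flip := by
  have := E.projective_P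
  have := E.projective_Q
  have hexact := lTensor_exact C E.exact_f_g E.surjective_g
  have hsurj := LinearMap.lTensor_surjective C E.surjective_g
  constructor
  · rw [injective_iff_map_eq_zero]
    intro t ht
    obtain ⟨y, rfl⟩ := E.surjective_g t
    obtain ⟨u, hu⟩ := hexact.exists_linearMap_lift E.lTensor_injective
      ((TensorProduct.mk R C E.Q).flip y) (by
        ext c
        exact LinearMap.congr_fun ht c)
    obtain ⟨x, rfl⟩ := hC.mk_flip_surjective E.P u
    have hxy : E.f x = y := by
      apply hC.mk_flip_injective E.Q
      rw [← hu]
      ext c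
      rfl
    exact (E.exact_f_g _).2 ⟨x, hxy⟩
  · intro v
    obtain ⟨A, B, i, e, hA, hB, hB', hi, hie, he, hext⟩ := hC.exists_presentation
    obtain ⟨s, r, hrs⟩ := exists_retract_finsupp (R := R) C E.P
    obtain ⟨w, hw⟩ := ExtendsAlong.exists_lift hie he hexact E.lTensor_injective hsurj
      (hext.finsupp.of_retract s r hrs) v
    obtain ⟨y, rfl⟩ := hC.mk_flip_surjective E.Q w
    refine ⟨E.g y, ?_⟩
    rw [← hw]
    ext c
    rfl

/-- For `I` injective, `Hom(C, I)` is a retract of `E.T`. -/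
theorem exists_retract (hC : IsSemidualizing R C) (E : CEmbedding R C M)
    (hM : Module.Injective R M) :
    ∃ (s : (C →ₗ[R] M) →ₗ[R] E.T) (r : E.T →ₗ[R] (C →ₗ[R] M)), r ∘ₗ s = LinearMap.id := by
  obtain ⟨ρ, hρ⟩ := hM.out E.ι E.injective_ι LinearMap.id
  let η := LinearEquiv.ofBijective _ (E.mk_flip_bijective hC)
  refine ⟨η.symm.toLinearMap ∘ₗ LinearMap.llcomp R C _ _ E.ι,
    LinearMap.llcomp R C _ _ ρ ∘ₗ η.toLinearMap, ?_⟩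
  ext v c
  have := LinearMap.congr_fun (η.apply_symm_apply (E.ι ∘ₗ v)) c
  refine (congrArg ρ this).trans (hρ _)

end CEmbedding

/-! ### Submodules of flat modules are `G_C`-flat. -/

section Hereditary

variable {C : Type u} [AddCommGroup C] [Module R C]

theorem torOneVanishes_hom_of_flat (hC : IsSemidualizing R C) (hR : IsGCHereditary R C)
    {I Y F : Type u} [AddCommGroup I] [Module R I] (hI : Module.Injective R I)
    [AddCommGroup Y] [Module R Y] [AddCommGroup F] [Module R F] [Module.Flat R F]
    {k : Y →ₗ[R] F} (hk : Function.Injective k) : TorOneVanishes R Y (C →ₗ[R] I) := by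
  obtain ⟨E⟩ := hR.nonempty_cEmbedding hC I
  obtain ⟨s, r, hrs⟩ := E.exists_retract hC hI
  exact (E.torOneVanishes_of_flat hC hk).of_retract_right s r hrs

theorem torOneVanishes_hom_of_isCFlat (hC : IsSemidualizing R C) (hR : IsGCHereditary R C)
    {I Y Z : Type u} [AddCommGroup I] [Module R I] (hI : Module.Injective R I)
    [AddCommGroup Y] [Module R Y] [AddCommGroup Z] [Module R Z] (hZ : IsCFlat R C Z)
    {k : Y →ₗ[R] Z} (hk : Function.Injective k) : TorOneVanishes R Y (C →ₗ[R] I) := by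
  obtain ⟨E⟩ := hR.nonempty_cEmbedding hC I
  obtain ⟨s, r, hrs⟩ := E.exists_retract hC hI
  exact (E.torOneVanishes_of_isCFlat hZ hk).of_retract_right s r hrs

/-- An exact two-sided sequence of flat modules and modules `C ⊗ F` with `F` flat stays exact
under `Hom(C, I) ⊗ -` for `I` injective. -/
theorem TwoSidedSeq.IsExact.isTensorExact (hC : IsSemidualizing R C) (hR : IsGCHereditary R C)
    {X : TwoSidedSeq R} (hX : X.IsExact) (hL : ∀ n, Module.Flat R (X.L n))
    (hK : ∀ n, IsCFlat R C (X.K n)) {I : Type u} [AddCommGroup I] [Module R I]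
    (hI : Module.Injective R I) : X.IsTensorExact (C →ₗ[R] I) where
  left n := by
    -- The relevant image is that of the map two places after the first one: from `L 1` it lies in
    -- the `C`-flat module `K 0`, from further left in a flat module.
    cases n with
    | zero =>
      exact lTensor_exact_of_torOneVanishes _ (hX.left 0) hX.midLeft
        (torOneVanishes_hom_of_isCFlat hC hR hI (hK 0) (Submodule.injective_subtype _))
    | succ n =>
      exact lTensor_exact_of_torOneVanishes _ (hX.left (n + 1)) (hX.left n)
        (torOneVanishes_hom_of_flat hC hR hI (Submodule.injective_subtype _))
  midLeft := lTensor_exact_of_torOneVanishes _ hX.midLeft hX.midRight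
    (torOneVanishes_hom_of_isCFlat hC hR hI (hK 1) (Submodule.injective_subtype _))
  midRight := lTensor_exact_of_torOneVanishes _ hX.midRight (hX.right 0)
    (torOneVanishes_hom_of_isCFlat hC hR hI (hK 2) (Submodule.injective_subtype _))
  right n := lTensor_exact_of_torOneVanishes _ (hX.right n) (hX.right (n + 1))
    (torOneVanishes_hom_of_isCFlat hC hR hI (hK (n + 3)) (Submodule.injective_subtype _))

/-- If `N` embeds in a flat module, then every embedding `N → C ⊗ T` obtained from proper
coresolutions has `T` flat. -/
theorem CEmbedding.flat_T (hC : IsSemidualizing R C) (hR : IsGCHereditary R C)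
    {N F : Type u} [AddCommGroup N] [Module R N] [AddCommGroup F] [Module R F] [Module.Flat R F]
    {k : N →ₗ[R] F} (hk : Function.Injective k) (E : CEmbedding R C N) :
    Module.Flat R E.T := by
  have := E.projective_P
  have := E.projective_Q
  apply Module.Flat.of_torOneVanishes
  intro X _ _
  obtain ⟨E'⟩ := hR.nonempty_cEmbedding hC X
  -- `C ⊗ T` is an extension of the image of `δ`, which lies in `K 0`, by `N`, which lies in `F`.
  -- This keeps `C ⊗ f` injective after tensoring with `E'.T`; restricting to `X ⊆ C ⊗ E'.T` then
  -- gives Tor₁(X, E.T) = 0.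
  have h1 : TorOneVanishes R (C ⊗[R] E.T) E'.T := by
    refine .of_extension (g := E.δ.rangeRestrict) E.injective_ι ?_ E.δ.surjective_rangeRestrict
      (E'.torOneVanishes_of_flat hC hk)
      (E'.torOneVanishes_of_isCFlat (E.isCProjective 0).isCFlat (Submodule.injective_subtype _))
    intro x
    rw [← E.exact_ι_δ x, Subtype.ext_iff]
    rfl
  have h2 : Function.Injective ((E.f.lTensor C).lTensor E'.T) :=
    h1.lTensor_injective E.lTensor_injective (lTensor_exact C E.exact_f_g E.surjective_g)
      (LinearMap.lTensor_surjective C E.surjective_g)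
  refine .of_presentation E.exact_f_g E.surjective_g (lTensor_injective_of_injective
    (k := (TensorProduct.comm R C E'.T).toLinearMap ∘ₗ E'.ι)
    ((TensorProduct.comm R C E'.T).injective.comp E'.injective_ι)
    (lTensor_tensorProduct_injective _ h2))

theorem exists_projective_resolution (R : Type u) [CommRing R] (M : Type u) [AddCommGroup M]
    [Module R M] : ∃ (L : ℕ → ModuleCat.{u} R) (d : ∀ n, L (n + 1) →ₗ[R] L n) (ε : L 0 →ₗ[R] M),
      (∀ n, Module.Projective R (L n)) ∧ Function.Surjective ε ∧ Function.Exact (d 0) ε ∧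
      ∀ n, Function.Exact (d (n + 1)) (d n) := by
  choose A B i p hB hi hip hp using
    fun X : ModuleCat.{u} R => exists_projective_presentation R X
  have key : ∀ (X : ModuleCat.{u} R) {Y : Type u} [AddCommGroup Y] [Module R Y]
      (f : X →ₗ[R] Y), Function.Injective f →
      Function.Exact (i X ∘ₗ p (A X)) (f ∘ₗ p X) := by
    intro X Y _ _ f hf x
    rw [LinearMap.comp_apply, map_eq_zero_iff _ hf, hip X x]
    constructor
    · rintro ⟨a, rfl⟩
      obtain ⟨b, rfl⟩ := hp _ a
      exact ⟨b, rfl⟩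
    · rintro ⟨b, rfl⟩
      exact ⟨_, rfl⟩
  -- `Z n` is the `n`-th syzygy, starting from `M` itself.
  let Z : ℕ → ModuleCat.{u} R := fun n => Nat.rec (ModuleCat.of R M) (fun _ X => A X) n
  exact ⟨fun n => B (Z n), fun n => i (Z n) ∘ₗ p (Z (n + 1)), p (ModuleCat.of R M),
    fun n => hB _, hp _, key (ModuleCat.of R M) (LinearMap.id : M →ₗ[R] M) Function.injective_id,
    fun n => key (Z (n + 1)) (i (Z n)) (hi _)⟩

/-- Splicing a left resolution and a right coresolution of `M`. -/
def TwoSidedSeq.splice {M : Type u} [AddCommGroup M] [Module R M] {L K : ℕ → ModuleCat.{u} R}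
    {T : Type u} [AddCommGroup T] [Module R T] (dL : ∀ n, L (n + 1) →ₗ[R] L n)
    (ε : L 0 →ₗ[R] M) (ι : M →ₗ[R] T) (δ : T →ₗ[R] K 0) (d : ∀ n, K n →ₗ[R] K (n + 1)) :
    TwoSidedSeq R where
  L := L
  K := fun n => Nat.casesOn n (ModuleCat.of R T) K
  dL := dL
  mid := ι ∘ₗ ε
  dK := fun n => Nat.casesOn n δ d

/-- Modules which embed in a flat module are `G_C`-flat. -/
theorem IsGCHereditary.isGCFlat_of_injective (hC : IsSemidualizing R C) (hR : IsGCHereditary R C)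
    {N F : Type u} [AddCommGroup N] [Module R N] [AddCommGroup F] [Module R F] [Module.Flat R F]
    {k : N →ₗ[R] F} (hk : Function.Injective k) : IsGCFlat R C N := by
  obtain ⟨E⟩ := hR.nonempty_cEmbedding hC N
  obtain ⟨L, d, ε, hL, hε, h0, h1⟩ := exists_projective_resolution R N
  let X := TwoSidedSeq.splice d ε E.ι E.δ E.d
  have hXL : ∀ n, Module.Flat R (X.L n) := fun n =>
    have := hL n
    inferInstanceAs (Module.Flat R (L n))
  have hXK : ∀ n, IsCFlat R C (X.K n) := by
    intro n
    cases n with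
    | zero => exact ⟨E.T, E.flat_T hC hR hk, ⟨LinearEquiv.refl R _⟩⟩
    | succ n => exact (E.isCProjective n).isCFlat
  have hX : X.IsExact := by
    refine ⟨h1, ?_, ?_, ?_⟩
    · intro x
      exact (map_eq_zero_iff _ E.injective_ι).trans (h0 x)
    · intro x
      refine (E.exact_ι_δ x).trans ?_
      constructor
      · rintro ⟨m, rfl⟩
        obtain ⟨y, rfl⟩ := hε m
        exact ⟨y, rfl⟩
      · rintro ⟨y, rfl⟩
        exact ⟨ε y, rfl⟩
    · intro n
      cases n with
      | zero => exact E.exact_δ_d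
      | succ n => exact E.exact_d n
  refine ⟨X, hXL, hXK, hX, ⟨(LinearEquiv.ofInjective E.ι E.injective_ι).trans
    (LinearEquiv.ofEq _ _ ?_)⟩, fun I _ _ hI => hX.isTensorExact hC hR hXL hXK hI⟩
  exact (LinearMap.range_comp_of_range_eq_top _ (LinearMap.range_eq_top.2 hε)).symm

end Hereditary

/-! ### Tensor products with powers of `R`. -/

/-- The canonical map `M ⊗ R^J → M^J` is injective. -/
def PowersEmbed (R : Type u) [CommRing R] (J : Type u) (M : Type*)
    [AddCommGroup M] [Module R M] : Prop :=
  Function.Injective (TensorProduct.piScalarRightHom R R M J)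

theorem piScalarRightHom_rTensor {J : Type u} {M M' : Type*} [AddCommGroup M] [Module R M]
    [AddCommGroup M'] [Module R M'] (f : M →ₗ[R] M') (x : M ⊗[R] (J → R)) :
    TensorProduct.piScalarRightHom R R M' J (f.rTensor (J → R) x) =
      fun j => f (TensorProduct.piScalarRightHom R R M J x j) := by
  induction x with
  | zero => ext; simp
  | tmul m r => ext; simp
  | add x y hx hy => ext j; simp [hx, hy]

namespace PowersEmbed

variable {J : Type u} {M M' : Type*} [AddCommGroup M] [Module R M] [AddCommGroup M'] [Module R M']

theorem rTensor_injective (h : PowersEmbed R J M) {f : M →ₗ[R] M'} (hf : Function.Injective f) :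
    Function.Injective (f.rTensor (J → R)) := by
  rw [injective_iff_map_eq_zero]
  intro x hx
  apply h
  rw [map_zero]
  ext j
  apply hf
  have := congrFun (piScalarRightHom_rTensor f x) j
  rw [hx, map_zero] at this
  rw [← this, Pi.zero_apply, Pi.zero_apply, map_zero]

theorem of_retract (h : PowersEmbed R J M) (s : M' →ₗ[R] M) (r : M →ₗ[R] M')
    (hrs : r ∘ₗ s = LinearMap.id) : PowersEmbed R J M' := by
  refine (injective_iff_map_eq_zero _).2 fun x hx => ?_
  have h1 : s.rTensor (J → R) x = 0 := by
    apply h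
    rw [piScalarRightHom_rTensor, hx, map_zero]
    ext j
    simp
  rw [← LinearMap.id_apply (R := R) x, ← LinearMap.rTensor_id, ← hrs, LinearMap.rTensor_comp,
    LinearMap.comp_apply, h1, map_zero]

theorem finsupp {ι : Type*} (h : PowersEmbed R J M) : PowersEmbed R J (ι →₀ M) := by
  classical
  refine (injective_iff_map_eq_zero _).2 fun x hx => ?_
  apply (TensorProduct.finsuppLeft R R M (J → R) ι).injective
  rw [map_zero]
  ext1 k
  rw [TensorProduct.finsuppLeft_apply]
  apply h
  rw [piScalarRightHom_rTensor, hx]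
  ext j
  simp

variable (R J) in
theorem self : PowersEmbed R J R := by
  refine (injective_iff_map_eq_zero _).2 fun x hx => ?_
  apply (TensorProduct.lid R (J → R)).injective
  rw [map_zero, ← hx]
  clear hx
  induction x with
  | zero => simp
  | tmul m r => ext; simp [mul_comm]
  | add x y hx hy => simp [hx, hy]

variable (R J) in
theorem pi_fin (n : ℕ) : PowersEmbed R J (Fin n → R) :=
  ((self R J).finsupp (ι := Fin n)).of_retract
    (Finsupp.linearEquivFunOnFinite R R _).symm.toLinearMap
    (Finsupp.linearEquivFunOnFinite R R _).toLinearMap (by ext; simp)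

end PowersEmbed

theorem piScalarRightHom_pi_fin_surjective (J : Type u) (n : ℕ) :
    Function.Surjective (TensorProduct.piScalarRightHom R R (Fin n → R) J) := by
  intro z
  refine ⟨∑ k, Pi.single k 1 ⊗ₜ[R] (fun j => z j k), ?_⟩
  ext j l
  simp [Finset.sum_apply, Pi.single_apply]

/-- A chase in R^m → R^n → M → 0: the relations needed are chosen coordinate by coordinate, and
finiteness of `m` assembles them into one tensor. -/
theorem PowersEmbed.of_finitePresentation (J : Type u) (M : Type*) [AddCommGroup M] [Module R M]
    [Module.FinitePresentation R M] : PowersEmbed R J M := by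
  obtain ⟨n, m, f, g, hf, hgf⟩ := Module.FinitePresentation.exists_fin' R M
  refine (injective_iff_map_eq_zero _).2 fun x hx => ?_
  obtain ⟨y, rfl⟩ := LinearMap.rTensor_surjective (J → R) hf x
  rw [piScalarRightHom_rTensor] at hx
  choose z hz using fun j => (hgf _).1 (congrFun hx j)
  obtain ⟨w, rfl⟩ := piScalarRightHom_pi_fin_surjective (R := R) J m z
  have hw : g.rTensor (J → R) w = y := by
    apply PowersEmbed.pi_fin R J n
    rw [piScalarRightHom_rTensor]
    exact funext hz
  exact (rTensor_exact (J → R) hgf hf _).2 ⟨w, hw⟩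

theorem TorOneVanishes.tensorProduct_left {X N F : Type u} [AddCommGroup X] [Module R X]
    [AddCommGroup N] [Module R N] [AddCommGroup F] [Module R F] [Module.Flat R F]
    (h : TorOneVanishes R X N) : TorOneVanishes R (X ⊗[R] F) N := by
  apply symm
  intro A B _ _ _ _ i p hi hip hp
  rw [LinearMap.rTensor_tensor]
  simpa using Module.Flat.rTensor_preserves_injective_linearMap (M := F) _
    (h.symm _ _ i p hi hip hp)

theorem exists_injective_embedding (R : Type u) [CommRing R] (M : Type u) [AddCommGroup M]
    [Module R M] : ∃ (E : ModuleCat.{u} R) (κ : M →ₗ[R] E), Module.Injective R E ∧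
      Function.Injective κ :=
  ⟨CategoryTheory.Injective.under (ModuleCat.of R M),
    (CategoryTheory.Injective.ι (ModuleCat.of R M)).hom,
    (Module.injective_iff_injective_object R _).2
      (CategoryTheory.Injective.injective_under (ModuleCat.of R M)),
    (ModuleCat.mono_iff_injective _).1 inferInstance⟩

/-- A `G_C`-projective module `M` has `Ext¹(M, C) = 0`. -/
theorem IsGCProjective.exists_presentation {C M : Type u} [AddCommGroup C] [Module R C]
    [AddCommGroup M] [Module R M] (h : IsGCProjective R C M) :
    ∃ (A B : ModuleCat.{u} R) (i : A →ₗ[R] B) (p : B →ₗ[R] M), Module.Projective R B ∧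
      Function.Injective i ∧ Function.Exact i p ∧ Function.Surjective p ∧ ExtendsAlong i C := by
  obtain ⟨X, hL, -, hX, ⟨e⟩, hW⟩ := h
  have hXC : X.IsHomExact C := (hW R inferInstance).congr (TensorProduct.rid R C).symm
  let q : X.L 0 →ₗ[R] M := e.symm.toLinearMap ∘ₗ X.mid.rangeRestrict
  have hq : Function.Surjective q := e.symm.surjective.comp X.mid.surjective_rangeRestrict
  let A := ModuleCat.of R (LinearMap.ker q)
  let i : A →ₗ[R] X.L 0 := (LinearMap.ker q).subtype
  have hi : Function.Injective i := Submodule.injective_subtype _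
  have hiq : Function.Exact i q := LinearMap.exact_subtype_ker_map q
  have hdq : Function.Exact (X.dL 0) q := by
    intro x
    rw [← hX.midLeft x]
    refine (map_eq_zero_iff e.symm e.symm.injective).trans ?_
    rw [Subtype.ext_iff]
    rfl
  obtain ⟨r, hr⟩ := hiq.exists_linearMap_lift hi (X.dL 0) hdq.linearMap_comp_eq_zero
  have hrs : Function.Surjective r := by
    intro a
    obtain ⟨x, hx⟩ := (hdq (i a)).1 ((hiq _).2 ⟨a, rfl⟩)
    exact ⟨x, hi (by rw [← hx, ← hr]; rfl)⟩
  refine ⟨A, X.L 0, i, q, hL 0, hi, hiq, hq, fun u => ?_⟩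
  obtain ⟨ψ, hψ⟩ := (hXC.left 0 (u ∘ₗ r)).1 (by
    ext x
    have h1 : r (X.dL 1 x) = 0 := hi (by
      rw [map_zero, ← LinearMap.comp_apply, hr]
      exact (hX.left 0 _).2 ⟨x, rfl⟩)
    simp [h1])
  refine ⟨ψ, ?_⟩
  rw [← LinearMap.cancel_right hrs, ← hψ, LinearMap.comp_assoc, hr]
  rfl

/-! ### Flatness of the powers R^J. -/

section Hereditary

variable {C : Type u} [AddCommGroup C] [Module R C]

/-- Over a `C`-Gorenstein hereditary ring every power of `C` has injective dimension at most
one. -/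
theorem IsGCHereditary.injective_of_exact (hR : IsGCHereditary R C) {J E E' : Type u}
    [AddCommGroup E] [Module R E] [AddCommGroup E'] [Module R E'] (hE : Module.Injective R E)
    {κ : (J → C) →ₗ[R] E} {p : E →ₗ[R] E'} (hκ : Function.Injective κ)
    (hκp : Function.Exact κ p) (hp : Function.Surjective p) : Module.Injective R E' := by
  apply Module.Baer.injective
  intro I φ
  -- An ideal is `G_C`-projective, so Ext¹(I, C^J) = 0 and `φ` lifts to `E`, where injectivity
  -- extends it to the ring.
  obtain ⟨A, B, i, q, hB, hi, hiq, hq, hext⟩ := (hR R inferInstance I).exists_presentation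
  obtain ⟨v, hv⟩ := ExtendsAlong.exists_lift hiq hq hκp hκ hp (hext.pi (J := J)) φ
  obtain ⟨w, hw⟩ := hE.out (Submodule.subtype I) (Submodule.injective_subtype I) v
  refine ⟨p ∘ₗ w, fun x hx => ?_⟩
  rw [← hv]
  exact congrArg p (hw ⟨x, hx⟩)

/-- Applying `Hom(C, -)` to an injective coresolution of `C^J` embeds `R^J` into `Hom(C, E)`. -/
theorem IsSemidualizing.exists_pi_embedding (hC : IsSemidualizing R C) {J E E' : Type u}
    [AddCommGroup E] [Module R E] [AddCommGroup E'] [Module R E']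
    {κ : (J → C) →ₗ[R] E} {p : E →ₗ[R] E'} (hκ : Function.Injective κ)
    (hκp : Function.Exact κ p) (hp : Function.Surjective p) :
    ∃ μ : (J → R) →ₗ[R] (C →ₗ[R] E), Function.Injective μ ∧
      Function.Exact μ (LinearMap.compRight R p : (C →ₗ[R] E) →ₗ[R] (C →ₗ[R] E')) ∧
      Function.Surjective (LinearMap.compRight R p : (C →ₗ[R] E) →ₗ[R] (C →ₗ[R] E')) := by
  let m : (J → R) →ₗ[R] C →ₗ[R] (J → C) := LinearMap.mk₂ R (fun r c j => r j • c)
    (fun r r' c => by ext; simp [add_smul]) (fun a r c => by ext; simp [mul_smul])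
    (fun r c c' => by ext; simp) (fun a r c => by ext j; exact smul_comm (r j) a c)
  refine ⟨LinearMap.llcomp R C _ _ κ ∘ₗ m, ?_, ?_, ?_⟩
  · rw [injective_iff_map_eq_zero]
    intro r hr
    ext j
    apply hC.homothety.1
    ext c
    have h1 : κ (m r c) = 0 := LinearMap.congr_fun hr c
    simpa [m] using congrFun ((map_eq_zero_iff κ hκ).1 h1) j
  · intro v
    constructor
    · intro hv
      obtain ⟨u, hu⟩ := hκp.exists_linearMap_lift hκ v hv
      choose r hr using fun j => hC.homothety.2 (LinearMap.proj j ∘ₗ u)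
      refine ⟨r, ?_⟩
      rw [← hu]
      ext c
      have : m r c = u c := by
        ext j
        exact LinearMap.congr_fun (hr j) c
      exact congrArg κ this
    · rintro ⟨r, rfl⟩
      ext c
      exact (hκp _).2 ⟨_, rfl⟩
  · intro v
    obtain ⟨A, B, i, e, -, -, hB, hi, hie, he, hext⟩ := hC.exists_presentation
    obtain ⟨w, hw⟩ := ExtendsAlong.exists_lift hie he hκp hκ hp (hext.pi (J := J)) v
    exact ⟨w, hw⟩

/-- `Tor₁(Y, R^J)` vanishes if `Y` embeds in a flat module. -/
theorem IsGCHereditary.torOneVanishes_pi_of_flat (hC : IsSemidualizing R C)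
    (hR : IsGCHereditary R C) (J : Type u) {Y F : Type u} [AddCommGroup Y] [Module R Y]
    [AddCommGroup F] [Module R F] [Module.Flat R F] {k : Y →ₗ[R] F}
    (hk : Function.Injective k) : TorOneVanishes R Y (J → R) := by
  obtain ⟨E, κ, hE, hκ⟩ := exists_injective_embedding R (J → C)
  let E' := ModuleCat.of R (E ⧸ LinearMap.range κ)
  let p : E →ₗ[R] E' := (LinearMap.range κ).mkQ
  have hp : Function.Surjective p := Submodule.mkQ_surjective _
  have hκp : Function.Exact κ p := LinearMap.exact_map_mkQ_range κ
  have hE' : Module.Injective R E' := hR.injective_of_exact hE hκ hκp hp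
  obtain ⟨μ, hμ, hμp, hps⟩ := hC.exists_pi_embedding hκ hκp hp
  obtain ⟨A, B, i, q, hB, hi, hiq, hq⟩ := exists_projective_presentation R Y
  apply TorOneVanishes.symm
  refine .of_presentation hiq hq ?_
  rw [lTensor_injective_iff_rTensor_injective]
  -- The syzygy `A` lies in the projective `B`, so Tor₁(A, Hom(C, E')) = 0. Together with Tor₁(Y,
  -- Hom(C, E)) = 0 this makes `A ⊗ R^J → B ⊗ Hom(C, E)` injective, and that map factors through `B
  -- ⊗ R^J`.
  have h1 : Function.Injective (μ.lTensor A) :=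
    (torOneVanishes_hom_of_flat hC hR hE' hi).symm.lTensor_injective hμ hμp hps
  have h2 : Function.Injective (i.rTensor (C →ₗ[R] E)) :=
    torOneVanishes_hom_of_flat hC hR hE hk _ _ i q hi hiq hq
  have h3 := h2.comp h1
  rw [← LinearMap.coe_comp, LinearMap.rTensor_comp_lTensor, ← LinearMap.lTensor_comp_rTensor,
    LinearMap.coe_comp] at h3
  exact h3.of_comp

/-- `Tor₁(C ⊗ T, R^J)` vanishes. -/
theorem CEmbedding.torOneVanishes_pi (hC : IsSemidualizing R C) {M : Type u} [AddCommGroup M]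
    [Module R M] (E : CEmbedding R C M) (J : Type u) :
    TorOneVanishes R (C ⊗[R] E.T) (J → R) := by
  have := E.projective_P
  have := E.projective_Q
  obtain ⟨A, B, i, e, hA, hB, hB', hi, hie, he, -⟩ := hC.exists_presentation
  have hCfp : Module.FinitePresentation R C := by
    have := Module.finitePresentation_of_projective R B
    refine Module.finitePresentation_of_surjective e he ?_
    rw [hie.linearMap_ker_eq]
    exact Submodule.FG.of_finite
  -- Here the finite presentation of the first syzygy of `C` enters, not only that of `C`.
  have hCJ : TorOneVanishes R C (J → R) :=
    .of_exact hie he (TorOneVanishes.of_flat_right (N := B)).symm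
      ((PowersEmbed.of_finitePresentation J A).rTensor_injective hi)
  obtain ⟨s, r, hrs⟩ := exists_retract_finsupp (R := R) C E.P
  exact .of_exact (lTensor_exact C E.exact_f_g E.surjective_g)
    (LinearMap.lTensor_surjective C E.surjective_g) hCJ.tensorProduct_left
    (((PowersEmbed.of_finitePresentation J C).finsupp.of_retract s r hrs).rTensor_injective
      E.lTensor_injective)

/-- Over a `C`-Gorenstein hereditary ring every power of `R` is flat. -/
theorem IsGCHereditary.flat_pi (hC : IsSemidualizing R C) (hR : IsGCHereditary R C)
    (J : Type u) : Module.Flat R (J → R) := by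
  obtain ⟨U, F, i, p, hF, hi, hip, hp⟩ := exists_projective_presentation R (J → R)
  -- In effect Tor₂(R/I, R^J) = Tor₁(I, R^J) = 0, so the first syzygy `U` of R^J is flat.
  have hU : Module.Flat R U := by
    rw [Module.Flat.iff_rTensor_injective']
    intro I
    have h1 : Function.Injective (i.lTensor I) :=
      (hR.torOneVanishes_pi_of_flat hC J (Submodule.injective_subtype I)).symm.lTensor_injective
        hi hip hp
    have h2 := (Module.Flat.rTensor_preserves_injective_linearMap (M := F) (Submodule.subtype I)
      (Submodule.injective_subtype I)).comp h1
    rw [← LinearMap.coe_comp, LinearMap.rTensor_comp_lTensor, ← LinearMap.lTensor_comp_rTensor,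
      LinearMap.coe_comp] at h2
    exact h2.of_comp
  apply Module.Flat.of_torOneVanishes
  intro X _ _
  obtain ⟨E⟩ := hR.nonempty_cEmbedding hC X
  -- Since `U` is flat, injectivity of `(C ⊗ T) ⊗ U → (C ⊗ T) ⊗ F` passes to the submodule `X` of `C
  -- ⊗ T`.
  exact .of_presentation hip hp (lTensor_injective_of_injective E.injective_ι
    ((E.torOneVanishes_pi hC J).symm.lTensor_injective hi hip hp))

end Hereditary

/-! ### Chase's criterion for coherence. -/

/-- A ring all of whose powers are flat is coherent. -/
theorem isCoherentRing_of_flat_pi (h : ∀ J : Type u, Module.Flat R (J → R)) :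
    IsCoherentRing R := by
  intro I hI
  have : Module.Finite R I := Module.Finite.iff_fg.2 hI
  obtain ⟨n, f, hf⟩ := Module.Finite.exists_fin' R I
  refine Module.finitePresentation_of_surjective f hf ?_
  -- The power is indexed by the relation module itself, so that the tautological family of all
  -- relations is a single element to lift to `Z ⊗ R^Z`.
  let Z := LinearMap.ker f
  have := h Z
  have hfZ : Function.Exact Z.subtype f := LinearMap.exact_subtype_ker_map f
  have hinj : PowersEmbed R Z I := by
    have h1 : Function.Injective ((Submodule.subtype I).rTensor (Z → R)) :=
      Module.Flat.rTensor_preserves_injective_linearMap _ (Submodule.injective_subtype I)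
    refine (injective_iff_map_eq_zero _).2 fun x hx => ?_
    apply h1
    apply PowersEmbed.self R Z
    rw [piScalarRightHom_rTensor, hx, map_zero, map_zero]
    rfl
  obtain ⟨y, hy⟩ := piScalarRightHom_pi_fin_surjective (R := R) Z n (fun z => z.1)
  have hy0 : f.rTensor (Z → R) y = 0 := by
    apply hinj
    rw [piScalarRightHom_rTensor, hy, map_zero]
    exact funext fun z => z.2
  obtain ⟨w, hw⟩ := (rTensor_exact (Z → R) hfZ hf y).1 hy0
  have hwz : ∀ z : Z, TensorProduct.piScalarRightHom R R Z Z w z = z := by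
    intro z
    have := congrFun (piScalarRightHom_rTensor Z.subtype w) z
    rw [hw, hy] at this
    exact Subtype.ext this.symm
  -- The coordinate of `w` at `z` is `z`, so the finitely many left factors of `w` generate all
  -- relations.
  obtain ⟨t, rfl⟩ := TensorProduct.exists_finset w
  classical
  refine Module.Finite.iff_fg.1 ⟨t.image Prod.fst, eq_top_iff.2 fun z _ => ?_⟩
  rw [← hwz z, map_sum, Finset.sum_apply]
  refine Submodule.sum_mem _ fun a ha => ?_
  rw [TensorProduct.piScalarRightHom_tmul]
  exact Submodule.smul_mem _ _ (Submodule.subset_span (by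
    rw [Finset.coe_image]
    exact ⟨a, ha, rfl⟩))

end

theorem theorem3p8 (R : Type u) [CommRing R] (C : Type u) [AddCommGroup C] [Module R C]
    (hC : IsSemidualizing R C) (hR : IsGCHereditary R C) :
    IsGCSemihereditary R C :=
  ⟨isCoherentRing_of_flat_pi (hR.flat_pi hC), fun _ _ _ _ N =>
    hR.isGCFlat_of_injective hC (Submodule.injective_subtype N)⟩
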